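/- Consider equivalence relations on finite linearly ordered sets, up to order-preserving isomorphism; thus each is represented uniquely by an equivalence relation $\rho$ on $[n]=\{1,\dots,n\}$ for some $n\ge 0$, and $|\rho|=n$ is its length. Write $\rho\le\sigma$ (the consecutive embedding order), for $\rho$ on $[m]$ and $\sigma$ on $[n]$, if there is a map $f:[m]\to[n]$ of the form $f(i)=k+i$ (for some fixed integer $k\ge 0$) such that $(x,y)\in\rho\iff(f(x),f(y))\in\sigma$ for all $x,y\in[m]$. Let $B$ be a nonempty finite set of such equivalence relations, let $$\operatorname{Av}(B)=\{\sigma:\ \beta\not\le\sigma\ \text{for all}\ \beta\in B\},$$ and let $b=\max\{|\beta|:\beta\in B\}$. The factor graph $\Gamma_B$ is the digraph whose vertices are the elements of $\operatorname{Av}(B)$ of length $b$, with an edge from $\mu$ to $\nu$ (loops allowed) if and only if the restriction of $\mu$ to $\{2,\dots,b\}$ and the restriction of $\nu$ to $\{1,\dots,b-1\}$ are isomorphic, i.e. for all $i,j\in[b-1]$, $(i+1,j+1)\in\mu\iff(i,j)\in\nu$. A cycle in a digraph is a sequence of vertices $v_1\to v_2\to\dots\to v_n$ with $n\ge 2$,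 $v_1=v_n$ and each $(v_i,v_{i+1})$ an edge (other repetitions of vertices are allowed). It is an in-out cycle if it contains a vertex whose in-degree in the digraph is at least two and a (possibly different) vertex whose out-degree in the digraph is at least two. A vertex $\nu$ of $\Gamma_B$ is special if $\{b\}$ is an equivalence class of $\nu$. Theorem. $\operatorname{Av}(B)$ is well quasi-ordered under the consecutive embedding order (that is, it has no infinite antichain and no infinite strictly descending chain) if and only if $\Gamma_B$ has no in-out cycle and no special vertex of $\Gamma_B$ lies on a cycle. -/

import Mathlib

/-- A finite equivalence relation on a linearly ordered set, taken up to isomorphism (contiguous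
bijections preserving the relation): every class has a unique representative on the standard
`n`-element chain, here `Fin n` with its natural order, entry `i : Fin n` being the
`(i+1)`-st smallest element of the underlying set. -/
structure FinEqRel where
  /-- the number of points -/
  length : ℕ
  /-- the equivalence relation -/
  rel : Setoid (Fin length)

namespace FinEqRel

/-- A map between finite chains is contiguous if it sends the chain to consecutive points,
in increasing order. -/
def Contiguous {m n : ℕ} (f : Fin m → Fin n) : Prop :=
  ∃ k : ℕ, ∀ i : Fin m, (f i : ℕ) = k + (i : ℕ)

/-- The consecutive embedding order: there is a contiguous map `f` such that `x`, `y` are related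
if and only if `f x`, `f y` are related. -/
def ConsEmbeds (ρ σ : FinEqRel) : Prop :=
  ∃ f : Fin ρ.length → Fin σ.length,
    Contiguous f ∧ ∀ x y, ρ.rel x y ↔ σ.rel (f x) (f y)

theorem Contiguous.injective {m n : ℕ} {f : Fin m → Fin n} (hf : Contiguous f) :
    Function.Injective f := by
  obtain ⟨k, hk⟩ := hf
  intro x y hxy
  have h1 := hk x
  have h2 := hk y
  rw [hxy] at h1
  exact Fin.ext (by omega)

theorem ConsEmbeds.length_le {ρ σ : FinEqRel} (h : ConsEmbeds ρ σ) :
    ρ.length ≤ σ.length := by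
  obtain ⟨f, hf, -⟩ := h
  simpa using Fintype.card_le_of_injective f hf.injective

/-- Finite equivalence relations up to isomorphism form a poset under `ConsEmbeds`. -/
instance : PartialOrder FinEqRel where
  le := ConsEmbeds
  le_refl ρ := ⟨id, ⟨0, fun i => by simp⟩, fun x y => Iff.rfl⟩
  le_trans := by
    rintro ρ σ τ ⟨f, ⟨k, hk⟩, hf⟩ ⟨g, ⟨l, hl⟩, hg⟩
    refine ⟨g ∘ f, ⟨l + k, fun i => ?_⟩, fun x y => (hf x y).trans (hg _ _)⟩
    simp only [Function.comp_apply, hl, hk]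
    omega
  le_antisymm := by
    rintro ⟨m, r⟩ ⟨n, s⟩ h h'
    obtain rfl : m = n := le_antisymm (ConsEmbeds.length_le h) (ConsEmbeds.length_le h')
    obtain ⟨f, ⟨k, hk⟩, hf⟩ := h
    have hid : ∀ i, f i = i := by
      intro i
      have hi : (i : ℕ) < m := i.isLt
      have hm : m - 1 < m := by omega
      have h1 := hk ⟨m - 1, hm⟩
      have h2 : (f ⟨m - 1, hm⟩ : ℕ) < m := (f ⟨m - 1, hm⟩).isLt
      have h3 := hk i
      apply Fin.ext
      simp only at h1
      omega
    have : r = s := by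
      ext x y
      have := hf x y
      rwa [hid, hid] at this
    rw [this]

/-- `restrict r k m h` is the restriction of `r` to the `m` consecutive entries
`k+1, …, k+m` (counting from `1`), relabelled by `1, …, m` in increasing order. -/
def restrict {n : ℕ} (r : Setoid (Fin n)) (k m : ℕ) (h : k + m ≤ n) : Setoid (Fin m) :=
  r.comap fun i : Fin m => (⟨k + (i : ℕ), by omega⟩ : Fin n)

/-- The set of equivalence relations avoiding `B` under the consecutive embedding order. -/
def Av (B : Finset FinEqRel) : Set FinEqRel :=
  {σ | ∀ β ∈ B, ¬ β ≤ σ}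

/-- `b = max {|β| : β ∈ B}` (for nonempty `B`). -/
def maxLength (B : Finset FinEqRel) : ℕ :=
  B.sup FinEqRel.length

/-- The digraph `G_b`: its vertices are the equivalence relations on `b` points, with an edge from
`μ` to `ν` iff the restriction of `μ` to its last `b - 1` entries is isomorphic to the restriction
of `ν` to its first `b - 1` entries. (On no points, there is no edge.) -/
def overlapGraph (b : ℕ) : Digraph (Setoid (Fin b)) where
  Adj μ ν := ∃ hb : 1 ≤ b,
    restrict μ 1 (b - 1) (by omega) = restrict ν 0 (b - 1) (by omega)

/-- Vertices of the factor graph: the elements of `Av B` of length `b`. -/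
abbrev FactorVertex (B : Finset FinEqRel) : Type :=
  {μ : Setoid (Fin (maxLength B)) // (⟨maxLength B, μ⟩ : FinEqRel) ∈ Av B}

/-- The factor graph `Γ_B`: the subgraph of `G_b` induced on the elements of `Av B`
of length `b`. -/
def factorGraph (B : Finset FinEqRel) : Digraph (FactorVertex B) where
  Adj μ ν := (overlapGraph (maxLength B)).Adj μ.1 ν.1

/-- A vertex of the factor graph is special if its largest entry is alone in its class. -/
def IsSpecial {B : Finset FinEqRel} (ν : FactorVertex B) : Prop :=
  ∃ t : Fin (maxLength B), (∀ i, i ≤ t) ∧ {j | ν.1 j t} = {t}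

end FinEqRel

namespace Digraph

/-- A cycle is a path `v₁ → v₂ → ⋯ → vₙ` with at least one edge and with `v₁ = vₙ`
(vertices may otherwise be repeated). -/
def IsCycle {V : Type*} (G : Digraph V) (c : List V) : Prop :=
  List.IsChain G.Adj c ∧ 2 ≤ c.length ∧ c.head? = c.getLast?

/-- The in-degree of a vertex. -/
noncomputable def inDeg {V : Type*} (G : Digraph V) (v : V) : ℕ∞ :=
  {u | G.Adj u v}.encard

/-- The out-degree of a vertex. -/
noncomputable def outDeg {V : Type*} (G : Digraph V) (v : V) : ℕ∞ :=
  {u | G.Adj v u}.encard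

/-- A cycle is an in-out cycle if it contains a vertex of in-degree at least two and a (possibly
different) vertex of out-degree at least two, the degrees being taken in the whole digraph. -/
def IsInOutCycle {V : Type*} (G : Digraph V) (c : List V) : Prop :=
  G.IsCycle c ∧ (∃ v ∈ c, 2 ≤ G.inDeg v) ∧ ∃ v ∈ c, 2 ≤ G.outDeg v

end Digraph

/-! With b = `maxLength B`, a relation of length at least b in `Av B` traces a walk of windows in
the factor graph. Conversely every walk is induced by a greedy colouring (`win_pathCol`), in which a
class never skips b or more points. Necessity: entering an in-out cycle off the cycle, winding ever
more often and leaving off the cycle gives a bad sequence. A special vertex on a cycle creates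
infinitely many classes, while only b can meet a given window, so some class dies; reviving it at
ever later births gives a bad sequence. Sufficiency: without in-out cycles, each strong component
containing a cycle has unique predecessors or unique successors, so a walk is a core of bounded
length with forced continuations on both sides (`exists_core`). Without special vertices on cycles,
no class is born or dies there, so forced windows force the whole relation (`AgreeOn.extend_left`,
`AgreeOn.extend_right`). An element is thus coded by its core and two lengths, and Dickson's lemma
applies. -/

namespace FinEqRel

/-! ### Colourings, windows and avoidance -/

/-- The equivalence relation on `n` points induced by the colours of `i, …, i + n - 1`. -/
def win (n : ℕ) (c : ℕ → ℕ) (i : ℕ) : Setoid (Fin n) :=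
  Setoid.ker fun a : Fin n => c (i + a)

/-- The finite equivalence relation induced by a colouring on the segment `i, …, i + n - 1`. -/
def seg (c : ℕ → ℕ) (i n : ℕ) : FinEqRel := ⟨n, win n c i⟩

theorem win_apply {n : ℕ} {c : ℕ → ℕ} {i : ℕ} (x y : Fin n) :
    win n c i x y ↔ c (i + x) = c (i + y) := Iff.rfl

theorem win_eq_iff {n : ℕ} {c d : ℕ → ℕ} {i j : ℕ} :
    win n c i = win n d j ↔
      ∀ x y, x < n → y < n → (c (i + x) = c (i + y) ↔ d (j + x) = d (j + y)) := by
  constructor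
  · intro h x y hx hy
    have := congrArg (fun r : Setoid (Fin n) => r ⟨x, hx⟩ ⟨y, hy⟩) h
    simpa [win_apply] using this
  · intro h
    ext x y
    exact h x y x.2 y.2

theorem seg_le_seg {c d : ℕ → ℕ} {i j m n s : ℕ} (hs : s + m ≤ n)
    (h : ∀ x y, x < m → y < m → (c (i + x) = c (i + y) ↔ d (j + (s + x)) = d (j + (s + y)))) :
    seg c i m ≤ seg d j n :=
  ⟨fun x => ⟨s + x, lt_of_lt_of_le (Nat.add_lt_add_left x.2 s) hs⟩, ⟨s, fun _ => rfl⟩,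
    fun x y => h x y x.2 y.2⟩

theorem exists_of_seg_le_seg {c d : ℕ → ℕ} {i j m n : ℕ} (h : seg c i m ≤ seg d j n) :
    ∃ s, s + m ≤ n ∧ ∀ x y, x < m → y < m →
      (c (i + x) = c (i + y) ↔ d (j + (s + x)) = d (j + (s + y))) := by
  obtain ⟨f, ⟨k, hk⟩, hf⟩ := h
  -- On the empty chain the shift `k` is unconstrained and may exceed `n`, so `0` is used instead.
  rcases Nat.eq_zero_or_pos m with rfl | hm
  · exact ⟨0, by omega, fun x y hx => by omega⟩
  · refine ⟨k, ?_, fun x y hx hy => ?_⟩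
    · have h1 := hk ⟨m - 1, by change m - 1 < m; omega⟩
      have h2 : (f ⟨m - 1, by change m - 1 < m; omega⟩ : ℕ) < n := (f _).isLt
      simp only at h1
      omega
    · have h1 := hf ⟨x, hx⟩ ⟨y, hy⟩
      have h2 : (seg d j n).rel (f ⟨x, hx⟩) (f ⟨y, hy⟩) ↔
        d (j + f ⟨x, hx⟩) = d (j + f ⟨y, hy⟩) := Iff.rfl
      rw [h2, hk, hk] at h1
      exact h1

theorem exists_eq_seg (σ : FinEqRel) : ∃ c : ℕ → ℕ, σ = seg c 0 σ.length := by
  classical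
  obtain ⟨n, r⟩ := σ
  obtain ⟨f, hf⟩ : ∃ f : Quotient r → ℕ, Function.Injective f :=
    ⟨fun q => Finite.equivFin (Quotient r) q,
      Fin.val_injective.comp (Finite.equivFin (Quotient r)).injective⟩
  refine ⟨fun x => if h : x < n then f ⟦⟨x, h⟩⟧ else 0, ?_⟩
  simp only [seg, FinEqRel.mk.injEq, heq_eq_eq, true_and]
  ext x y
  simp [win_apply, hf.eq_iff, Quotient.eq]

variable {B : Finset FinEqRel}

theorem mem_Av_of_le {σ τ : FinEqRel} (h : σ ≤ τ) (hτ : τ ∈ Av B) : σ ∈ Av B :=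
  fun β hβ hle => hτ β hβ (hle.trans h)

theorem seg_mem_Av_of_seg_mem_Av {c : ℕ → ℕ} {n i m : ℕ} (h : seg c 0 n ∈ Av B)
    (hi : i + m ≤ n) : seg c i m ∈ Av B :=
  mem_Av_of_le (seg_le_seg hi fun x y _ _ => by simp) h

/-- A relation whose factors of length `maxLength B` all avoid `B` avoids `B`. -/
theorem seg_mem_Av {c : ℕ → ℕ} {n : ℕ} (hn : maxLength B ≤ n)
    (h : ∀ i, i + maxLength B ≤ n → seg c i (maxLength B) ∈ Av B) : seg c 0 n ∈ Av B := by
  intro β hβ hle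
  have hb : β.length ≤ maxLength B := Finset.le_sup (f := FinEqRel.length) hβ
  obtain ⟨d, hd⟩ := exists_eq_seg β
  rw [hd] at hle
  obtain ⟨s, hs, hs'⟩ := exists_of_seg_le_seg hle
  set b := maxLength B with hbdef
  -- A window starting at `s` could overrun the end; then the last window also contains the
  -- occurrence of `β`.
  set t := min s (n - b) with ht
  refine h t (by omega) β hβ ?_
  rw [hd]
  refine seg_le_seg (s := s - t) (by omega) fun x y hx hy => ?_
  rw [hs' x y hx hy]
  have : ∀ x, t + (s - t + x) = 0 + (s + x) := fun x => by omega
  rw [this, this]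

theorem overlapGraph_adj_win {b : ℕ} (hb : 1 ≤ b) (c : ℕ → ℕ) (i : ℕ) :
    (overlapGraph b).Adj (win b c i) (win b c (i + 1)) := by
  refine ⟨hb, ?_⟩
  ext x y
  have : ∀ x, i + 1 + (0 + x) = i + (1 + x) := fun x => by omega
  change c (i + (1 + x)) = c (i + (1 + y)) ↔ c (i + 1 + (0 + x)) = c (i + 1 + (0 + y))
  rw [this, this]

theorem overlapGraph_adj_iff {b : ℕ} {μ ν : Setoid (Fin b)} :
    (overlapGraph b).Adj μ ν ↔ 1 ≤ b ∧ ∀ x y (hx : x + 1 < b) (hy : y + 1 < b),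
      μ ⟨x + 1, hx⟩ ⟨y + 1, hy⟩ ↔ ν ⟨x, by omega⟩ ⟨y, by omega⟩ := by
  have e1 : ∀ (h : 1 + (b - 1) ≤ b) (x y : Fin (b - 1)), restrict μ 1 (b - 1) h x y ↔
      μ ⟨x + 1, by omega⟩ ⟨y + 1, by omega⟩ := by
    intro h x y
    simp only [add_comm _ 1]
    rfl
  have e2 : ∀ (h : 0 + (b - 1) ≤ b) (x y : Fin (b - 1)), restrict ν 0 (b - 1) h x y ↔
      ν ⟨x, by omega⟩ ⟨y, by omega⟩ := by
    intro h x y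
    change ν ⟨0 + x, by omega⟩ ⟨0 + y, by omega⟩ ↔ _
    simp only [zero_add]
  constructor
  · rintro ⟨hb, h⟩
    refine ⟨hb, fun x y hx hy => ?_⟩
    rw [← e1 (by omega) ⟨x, by omega⟩ ⟨y, by omega⟩, h, e2]
  · rintro ⟨hb, h⟩
    refine ⟨hb, ?_⟩
    ext x y
    rw [e1, e2, h]

/-! ### From walks of windows to relations -/

section PathCol

variable {b : ℕ} (p : ℕ → Setoid (Fin b))

/-- `z` and `y` lie in the window of length `b` starting at `s` and are related in `p s`. -/
def LocalRel (s z y : ℕ) : Prop :=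
  ∃ (hz : z - s < b) (hy : y - s < b), p s ⟨z - s, hz⟩ ⟨y - s, hy⟩

open Classical in
/-- The greedy colouring along a path of windows: a point gets the colour of an earlier point of its
window related to it, and a new colour if there is none. -/
noncomputable def pathCol (y : ℕ) : ℕ :=
  if h : ∃ z, z < y ∧ y - (b - 1) ≤ z ∧ LocalRel p (y - (b - 1)) z y then
    pathCol h.choose
  else y
termination_by y
decreasing_by exact h.choose_spec.1

theorem pathCol_cases (y : ℕ) :
    (∃ z, z < y ∧ y - (b - 1) ≤ z ∧ LocalRel p (y - (b - 1)) z y ∧ pathCol p y = pathCol p z) ∨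
    ((¬ ∃ z, z < y ∧ y - (b - 1) ≤ z ∧ LocalRel p (y - (b - 1)) z y) ∧ pathCol p y = y) := by
  by_cases h : ∃ z, z < y ∧ y - (b - 1) ≤ z ∧ LocalRel p (y - (b - 1)) z y
  · left
    refine ⟨h.choose, h.choose_spec.1, h.choose_spec.2.1, h.choose_spec.2.2, ?_⟩
    rw [pathCol, dif_pos h]
  · right
    refine ⟨h, ?_⟩
    rw [pathCol, dif_neg h]

theorem pathCol_le (y : ℕ) : pathCol p y ≤ y := by
  induction y using Nat.strong_induction_on with
  | _ y ih =>
    rcases pathCol_cases p y with ⟨z, hz, -, -, h⟩ | ⟨-, h⟩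
    · have := ih z hz
      omega
    · omega

/-- A fresh colour `y` exceeds all earlier ones, so an old colour is always inherited from a point
at distance less than `b`. -/
theorem exists_near_of_pathCol_eq {x y : ℕ} (hxy : x < y) (h : pathCol p x = pathCol p y) :
    ∃ z, x ≤ z ∧ z < y ∧ y < z + b ∧ pathCol p z = pathCol p y := by
  rcases pathCol_cases p y with ⟨z, hz, hz', ⟨h1, h2, -⟩, hc⟩ | ⟨-, hc⟩
  · rcases le_or_gt x z with hx | hx
    · exact ⟨z, hx, hz, by omega, hc.symm⟩
    · exact ⟨x, le_rfl, hxy, by omega, h⟩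
  · have := pathCol_le p x
    omega

variable {p}

theorem localRel_succ {i z y : ℕ} (h : (overlapGraph b).Adj (p i) (p (i + 1)))
    (hz : i + 1 ≤ z) (hy : i + 1 ≤ y) (hz' : z < i + b) (hy' : y < i + b) :
    LocalRel p i z y ↔ LocalRel p (i + 1) z y := by
  have key := (overlapGraph_adj_iff.1 h).2 (z - (i + 1)) (y - (i + 1)) (by omega) (by omega)
  have e1 : z - (i + 1) + 1 = z - i := by omega
  have e2 : y - (i + 1) + 1 = y - i := by omega
  simp only [e1, e2] at key
  constructor
  · rintro ⟨_, _, h⟩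
    exact ⟨by omega, by omega, key.1 h⟩
  · rintro ⟨_, _, h⟩
    exact ⟨by omega, by omega, key.2 h⟩

theorem localRel_of_le {s i z y : ℕ} (hsi : s ≤ i)
    (h : ∀ j < i, (overlapGraph b).Adj (p j) (p (j + 1)))
    (hz : i ≤ z) (hy : i ≤ y) (hz' : z < s + b) (hy' : y < s + b) :
    LocalRel p s z y ↔ LocalRel p i z y := by
  induction i, hsi using Nat.le_induction with
  | base => rfl
  | succ i hi ih =>
    rw [ih (fun j hj => h j (by omega)) (by omega) (by omega)]
    exact localRel_succ (h i (by omega)) hz hy (by omega) (by omega)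

theorem localRel_iff_pathCol_eq_of_lt (y : ℕ) : ∀ i z, z < y → i ≤ z → y < i + b →
    (∀ j < i, (overlapGraph b).Adj (p j) (p (j + 1))) →
    (LocalRel p i z y ↔ pathCol p z = pathCol p y) := by
  induction y using Nat.strong_induction_on with
  | _ y ih =>
    intro i z hzy hiz hyi hadj
    -- The earliest window containing `y`; truncation gives window `0` when `y < b - 1`. The
    -- overlaps carry its relation to window `i`.
    set s := y - (b - 1) with hs
    have hsi : s ≤ i := by omega
    rw [← localRel_of_le hsi hadj hiz (by omega) (by omega) (by omega)]
    have hadj' : ∀ j < s, (overlapGraph b).Adj (p j) (p (j + 1)) := fun j hj => hadj j (by omega)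
    rcases pathCol_cases p y with ⟨w, hw, hw', hr, hc⟩ | ⟨hn, hc⟩
    · rw [hc]
      rw [← hs] at hw' hr
      -- Transitivity replaces `y` by the earlier point `w`, to which the induction applies.
      have e : LocalRel p s z y ↔ LocalRel p s z w := by
        obtain ⟨h1, h2, hr⟩ := hr
        constructor
        · rintro ⟨h3, h4, hr'⟩
          exact ⟨h3, h1, (p s).trans' hr' ((p s).symm' hr)⟩
        · rintro ⟨h3, h4, hr'⟩
          exact ⟨h3, h2, (p s).trans' hr' hr⟩
      rw [e]
      rcases lt_trichotomy z w with h | h | h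
      · exact ih w hw s z h (by omega) (by omega) hadj'
      · subst h
        exact iff_of_true ⟨by omega, by omega, (p s).refl' _⟩ rfl
      · rw [eq_comm (a := pathCol p z), ← ih z hzy s w h hw' (by omega) hadj']
        exact ⟨fun ⟨h1, h2, h⟩ => ⟨h2, h1, (p s).symm' h⟩,
          fun ⟨h1, h2, h⟩ => ⟨h2, h1, (p s).symm' h⟩⟩
    · refine iff_of_false (fun h => hn ⟨z, hzy, by omega, h⟩) ?_
      have := pathCol_le p z
      omega

/-- The greedy colouring of a path of windows induces the windows of the path. -/
theorem win_pathCol {i : ℕ} (hadj : ∀ j < i, (overlapGraph b).Adj (p j) (p (j + 1))) :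
    win b (pathCol p) i = p i := by
  have key : ∀ x y : Fin b, x < y → (pathCol p (i + x) = pathCol p (i + y) ↔ p i x y) := by
    intro x y hxy
    have hxy' : (x : ℕ) < y := hxy
    rw [← localRel_iff_pathCol_eq_of_lt (i + y) i (i + x) (by omega) (by omega) (by omega) hadj]
    simp [LocalRel]
  ext x y
  rw [win_apply]
  rcases lt_trichotomy x y with h | h | h
  · exact key x y h
  · subst h
    exact iff_of_true rfl ((p i).refl' _)
  · rw [eq_comm, key y x h]
    exact ⟨(p i).symm', (p i).symm'⟩

end PathCol

end FinEqRel

/-! ### Cycles and degrees -/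

namespace Digraph

variable {V : Type*} {G : Digraph V}

/-- A cycle is traversed by a periodic infinite walk. -/
theorem IsCycle.exists_periodic {q : List V} (h : G.IsCycle q) :
    ∃ (w : ℕ → V) (l : ℕ), 0 < l ∧ (∀ t, G.Adj (w t) (w (t + 1))) ∧ (∀ t, w (t + l) = w t) ∧
      ∀ v ∈ q, ∃ t, w t = v := by
  obtain ⟨hc, h2, h3⟩ := h
  have hlt : ∀ t, t % (q.length - 1) < q.length := fun t =>
    (Nat.mod_lt _ (by omega)).trans_le (by omega)
  have hlast : q[q.length - 1] = q[0] := by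
    rw [List.head?_eq_getElem?, List.getLast?_eq_getElem?, List.getElem?_eq_getElem (by omega),
      List.getElem?_eq_getElem (by omega)] at h3
    exact (Option.some.inj h3).symm
  rw [List.isChain_iff_getElem] at hc
  -- The last vertex of the list repeats the first, so the period is one less than its length.
  refine ⟨fun t => q[t % (q.length - 1)]'(hlt t), q.length - 1, by omega, fun t => ?_, fun t => ?_,
    fun v hv => ?_⟩
  · have ht := Nat.mod_lt t (show q.length - 1 > 0 by omega)
    have := hc (t % (q.length - 1)) (by omega)
    rcases Nat.lt_or_ge (t % (q.length - 1) + 1) (q.length - 1) with h | h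
    · have e : (t + 1) % (q.length - 1) = t % (q.length - 1) + 1 := by
        rw [← Nat.mod_add_mod, Nat.mod_eq_of_lt h]
      simpa only [e] using this
    · have e : t % (q.length - 1) + 1 = q.length - 1 := by omega
      have e' : (t + 1) % (q.length - 1) = 0 := by
        rw [← Nat.mod_add_mod, e, Nat.mod_self]
      simp only [e, hlast] at this
      simpa only [e'] using this
  · simp
  · obtain ⟨i, hi, rfl⟩ := List.getElem_of_mem hv
    rcases Nat.lt_or_ge i (q.length - 1) with h | h
    · exact ⟨i, by simp only [Nat.mod_eq_of_lt h]⟩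
    · obtain rfl : i = q.length - 1 := by omega
      exact ⟨0, by simpa using hlast.symm⟩

theorem two_le_inDeg_iff {v : V} : 2 ≤ G.inDeg v ↔ ∃ x y, G.Adj x v ∧ G.Adj y v ∧ x ≠ y := by
  rw [inDeg, ← one_add_one_eq_two, ENat.add_one_le_iff (by simp), Set.one_lt_encard_iff]
  simp

theorem two_le_outDeg_iff {v : V} : 2 ≤ G.outDeg v ↔ ∃ x y, G.Adj v x ∧ G.Adj v y ∧ x ≠ y := by
  rw [outDeg, ← one_add_one_eq_two, ENat.add_one_le_iff (by simp), Set.one_lt_encard_iff]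
  simp

end Digraph

/-! ### Necessity: two bad sequences -/

namespace FinEqRel

variable {B : Finset FinEqRel}

theorem not_wellQuasiOrderedLE_Av (σ : ℕ → FinEqRel) (h : ∀ k, σ k ∈ Av B)
    (h' : ∀ m n, m < n → ¬ σ m ≤ σ n) : ¬ WellQuasiOrderedLE ↥(Av B) := by
  intro hw
  obtain ⟨m, n, hmn, hle⟩ := hw.wqo fun k => ⟨σ k, h k⟩
  exact h' m n hmn hle

theorem seg_pathCol_mem_Av {p : ℕ → FactorVertex B} {m : ℕ}
    (hp : ∀ j < m, (factorGraph B).Adj (p j) (p (j + 1))) :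
    seg (pathCol fun i => (p i).1) 0 (maxLength B + m) ∈ Av B := by
  refine seg_mem_Av (by omega) fun i hi => ?_
  rw [seg, win_pathCol fun j hj => hp j (by omega)]
  exact (p i).2

theorem not_wellQuasiOrderedLE_of_isInOutCycle {c : List (FactorVertex B)}
    (h : (factorGraph B).IsInOutCycle c) : ¬ WellQuasiOrderedLE ↥(Av B) := by
  obtain ⟨hc, ⟨u, hu, hin⟩, ⟨v, hv, hout⟩⟩ := h
  obtain ⟨w, l, hl, hadj, hper, hmem⟩ := hc.exists_periodic
  have hper' : ∀ k t, w (t + l * k) = w t := by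
    intro k t
    induction k with
    | zero => simp
    | succ k ih => rw [Nat.mul_succ, ← add_assoc, hper, ih]
  obtain ⟨i, x, hxu, hxi⟩ : ∃ i x, (factorGraph B).Adj x (w (i + 1)) ∧ x ≠ w i := by
    obtain ⟨i, rfl⟩ := hmem u hu
    obtain ⟨x, y, hx, hy, hxy⟩ := Digraph.two_le_inDeg_iff.1 hin
    -- Adding a period makes the predecessor index meaningful even for `i = 0`.
    have e : w (i + l - 1 + 1) = w i := by rw [Nat.sub_add_cancel (by omega), hper]
    by_cases hxe : x = w (i + l - 1)
    · exact ⟨i + l - 1, y, by rwa [e], fun h => hxy (hxe.trans h.symm)⟩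
    · exact ⟨i + l - 1, x, by rwa [e], hxe⟩
  obtain ⟨j, y, hjy, hyj⟩ : ∃ j y, (factorGraph B).Adj (w j) y ∧ y ≠ w (j + 1) := by
    obtain ⟨j, rfl⟩ := hmem v hv
    obtain ⟨x, y, hx, hy, hxy⟩ := Digraph.two_le_outDeg_iff.1 hout
    by_cases hxe : x = w (j + 1)
    · exact ⟨j, y, hy, fun h => hxy (hxe.trans h.symm)⟩
    · exact ⟨j, x, hx, hxe⟩
  obtain ⟨r, hr⟩ : ∃ r, i + r = j + l * i := by
    have := Nat.le_mul_of_pos_left i hl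
    exact ⟨j + l * i - i, by omega⟩
  -- the number of cycle vertices on the `k`-th path
  let T : ℕ → ℕ := fun k => r + l * (k + 1)
  have hT : ∀ m n, m < n → T m < T n := fun m n hmn =>
    Nat.add_lt_add_left (Nat.mul_lt_mul_of_pos_left (by omega) hl) _
  have hTl : ∀ k, l ≤ T k := fun k => by
    have : l * 1 ≤ l * (k + 1) := Nat.mul_le_mul_left l (by omega)
    simp only [T]
    omega
  have hwT : ∀ k t, w (i + T k + t) = w (j + t) := by
    intro k t
    have : i + T k + t = j + t + l * (i + (k + 1)) := by
      simp only [T, Nat.mul_add l i]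
      omega
    rw [this, hper']
  let p : ℕ → ℕ → FactorVertex B := fun k t =>
    if t = 0 then x else if t ≤ T k then w (i + t) else y
  have p0 : ∀ k, p k 0 = x := fun k => by simp [p]
  have pw : ∀ k t, 0 < t → t ≤ T k → p k t = w (i + t) := fun k t h0 h1 => by
    simp [p, h1, h0.ne']
  have py : ∀ k, p k (T k + 1) = y := fun k => by simp [p]
  have hp : ∀ k, ∀ t < T k + 1, (factorGraph B).Adj (p k t) (p k (t + 1)) := by
    intro k t ht
    have := hTl k
    rcases Nat.eq_zero_or_pos t with rfl | h0
    · rw [p0, pw k _ (by omega) (by omega)]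
      exact hxu
    · rw [pw k t h0 (by omega)]
      rcases Nat.lt_or_ge t (T k) with h | h
      · rw [pw k _ (by omega) (by omega)]
        exact hadj _
      · obtain rfl : t = T k := by omega
        rw [py]
        have := hwT k 0
        rw [add_zero, add_zero] at this
        rwa [this]
  refine not_wellQuasiOrderedLE_Av
    (fun k => seg (pathCol fun t => (p k t).1) 0 (maxLength B + (T k + 1)))
    (fun k => seg_pathCol_mem_Av (hp k)) fun m n hmn hle => ?_
  obtain ⟨s, hs, hcol⟩ := exists_of_seg_le_seg hle
  have hpp : ∀ t ≤ T m + 1, p m t = p n (s + t) := by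
    intro t ht
    apply Subtype.ext
    have h1 := win_pathCol (p := fun t => (p m t).1) (i := t) fun j hj => hp m j (by omega)
    have h2 := win_pathCol (p := fun t => (p n t).1) (i := s + t) fun j hj => hp n j (by omega)
    rw [← h1, ← h2, win_eq_iff]
    intro a a' ha ha'
    have := hcol (t + a) (t + a') (by omega) (by omega)
    simpa only [zero_add, add_assoc] using this
  have hmn' := hT m n hmn
  have hm := hTl m
  -- With no shift, the shorter path exits through `y` where the longer one continues to `w (j +
  -- 1)`. With a positive shift, `x` would be `w (i + s)`; comparing one period later, inside both
  -- cycle parts because `l ≤ T m`, identifies it with `w i`.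
  rcases Nat.eq_zero_or_pos s with rfl | hs0
  · have := hpp (T m + 1) le_rfl
    rw [py, zero_add, pw n _ (by omega) (by omega), ← add_assoc, hwT] at this
    exact hyj this
  · have hshift : ∀ t, 0 < t → t ≤ T m → s + t ≤ T n → w (i + t) = w (i + (s + t)) := by
      intro t h0 h1 h2
      rw [← pw m t h0 h1, hpp t (by omega), pw n _ (by omega) h2]
    have h0 := hpp 0 (by omega)
    rw [p0, add_zero, pw n s hs0 (by omega)] at h0
    have h1 := hshift l hl hm (by omega)
    rw [hper, ← add_assoc, hper, ← h0] at h1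
    exact hxi h1.symm

theorem not_wellQuasiOrderedLE_of_isSpecial_mem_isCycle {c : List (FactorVertex B)}
    (h : (factorGraph B).IsCycle c) {ν : FactorVertex B} (hν : ν ∈ c) (hs : IsSpecial ν) :
    ¬ WellQuasiOrderedLE ↥(Av B) := by
  obtain ⟨w, l, hl, hadj, hper, hmem⟩ := h.exists_periodic
  obtain ⟨i, rfl⟩ := hmem ν hν
  have hb : 1 ≤ maxLength B := (overlapGraph_adj_iff.1 (hadj i)).1
  set b := maxLength B with hbdef
  have hper' : ∀ k, w (i + l * k) = w i := by
    intro k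
    induction k with
    | zero => simp
    | succ k ih => rw [Nat.mul_succ, ← add_assoc, hper, ih]
  let col := pathCol fun t => (w (i + t)).1
  have hwin : ∀ t, win b col t = (w (i + t)).1 := fun t => win_pathCol fun j _ => hadj _
  have hspec : ∀ (x : ℕ) (_ : x < b - 1), ¬ (w i).1 ⟨x, by omega⟩ ⟨b - 1, by omega⟩ := by
    intro x hx hrel
    obtain ⟨t, ht, ht'⟩ := hs
    have e : t = ⟨b - 1, by omega⟩ :=
      le_antisymm (Fin.le_def.2 (by change (t : ℕ) ≤ b - 1; omega)) (ht _)
    subst e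
    have : (⟨x, by omega⟩ : Fin b) ∈ ({⟨b - 1, by omega⟩} : Set (Fin b)) := by
      rw [← ht']
      exact hrel
    have := Fin.ext_iff.1 (Set.mem_singleton_iff.1 this)
    simp only at this
    omega
  have hnear : ∀ x y, x < y → col x = col y → ∃ z, x ≤ z ∧ z < y ∧ y < z + b ∧ col z = col y :=
    fun x y => exists_near_of_pathCol_eq _
  -- the points `b - 1 + l * k` start new classes
  have hborn : ∀ k x, x < l * k + (b - 1) → col x ≠ col (l * k + (b - 1)) := by
    intro k x hx he
    obtain ⟨z, -, hz, hz', hc⟩ := hnear _ _ hx he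
    have h1 := hspec (z - l * k) (by omega)
    rw [← hper' k, ← hwin, win_apply] at h1
    apply h1
    change col (l * k + (z - l * k)) = col (l * k + (b - 1))
    rwa [Nat.add_sub_cancel' (by omega)]
  have hinj : ∀ k k', k < k' → col (l * k + (b - 1)) ≠ col (l * k' + (b - 1)) := fun k k' hk =>
    hborn k' _ (Nat.add_lt_add_right (Nat.mul_lt_mul_of_pos_left hk hl) _)
  -- a class that is met arbitrarily far meets every later window
  have hmeet : ∀ a, (∀ D, ∃ y, D ≤ y ∧ col y = col a) →
      ∀ X, a ≤ X → ∃ z : Fin b, col (X + z) = col a := by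
    intro a ha X hX
    obtain ⟨hy, hy'⟩ := Nat.find_spec (ha X)
    set y := Nat.find (ha X) with hydef
    by_cases hya : a < y
    · obtain ⟨z, hz1, hz2, hz3, hz4⟩ := hnear a y hya hy'.symm
      have : z < X := by
        by_contra hzX
        exact Nat.find_min (ha X) hz2 ⟨by omega, hz4.trans hy'⟩
      refine ⟨⟨y - X, by omega⟩, ?_⟩
      rwa [Nat.add_sub_cancel' hy]
    · exact ⟨⟨0, by omega⟩, by
        obtain rfl : X = a := by omega
        rfl⟩
  -- If no class died, the `b + 1` classes born at `l * k + (b - 1)`, `k ≤ b`, would all meet the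
  -- window of `b` points starting at `l * b + b`.
  obtain ⟨k, hk⟩ : ∃ k, ∃ D, ∀ y, D ≤ y → col y ≠ col (l * k + (b - 1)) := by
    by_contra hcon
    push Not at hcon
    have : ∀ k : Fin (b + 1), ∃ z : Fin b, col (l * b + b + z) = col (l * k + (b - 1)) := by
      intro k
      refine hmeet _ (hcon k) _ ?_
      have := Nat.mul_le_mul_left l (show (k : ℕ) ≤ b by omega)
      omega
    choose g hg using this
    obtain ⟨k, k', hkk, hgk⟩ := Fintype.exists_ne_map_eq_of_card_lt g (by simp)
    have e : col (l * k + (b - 1)) = col (l * k' + (b - 1)) := by rw [← hg, ← hg, hgk]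
    rcases lt_or_gt_of_ne hkk with h | h
    · exact hinj _ _ h e
    · exact hinj _ _ h e.symm
  obtain ⟨D, hD⟩ := hk
  -- the last point of this class
  obtain ⟨a, ha⟩ : ∃ a, ∀ y, a < y → col y ≠ col a := by
    classical
    set e := l * k + (b - 1) with he
    have hP := Nat.findGreatest_spec (P := fun y => col y = col e) (n := max e D)
      (le_max_left e D) rfl
    refine ⟨Nat.findGreatest (fun y => col y = col e) (max e D), fun y hy hc => ?_⟩
    rw [hP] at hc
    by_cases hyD : y ≤ max e D
    · exact Nat.findGreatest_is_greatest hy hyD hc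
    · exact hD y (by omega) hc
  -- the last point of the `m`-th relation
  let N : ℕ → ℕ := fun m => l * (a + 1 + m) + (b - 1)
  have hN : ∀ m n, m < n → N m < N n := fun m n hmn =>
    Nat.add_lt_add_right (Nat.mul_lt_mul_of_pos_left (by omega) hl) _
  have haN : ∀ m, a + b ≤ N m := fun m => by
    have : a + 1 + m ≤ l * (a + 1 + m) := Nat.le_mul_of_pos_left _ hl
    simp only [N]
    omega
  -- The newborn class at `N m` is merged with the dead class of `a`. Since `a + b ≤ N m`, no window
  -- of length `b` sees both, so all windows survive.
  let d : ℕ → ℕ → ℕ := fun m x => if x = N m then col a else col x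
  have dN : ∀ m, d m (N m) = col a := fun m => by simp [d]
  have dlt : ∀ m x, x < N m → d m x = col x := fun m x hx => by simp [d, hx.ne]
  have hwind : ∀ m t, t + b ≤ N m + 1 → win b (d m) t = win b col t := by
    intro m t ht
    rcases Nat.lt_or_ge (t + b) (N m + 1) with h | h
    · rw [win_eq_iff]
      intro x y hx hy
      rw [dlt m _ (by omega), dlt m _ (by omega)]
    · have ht' : t = l * (a + 1 + m) := by simp only [N] at ht h; omega
      have hat := haN m
      have hne : ∀ x, x < b → x ≠ b - 1 → d m (t + x) ≠ d m (t + (b - 1)) ∧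
          col (t + x) ≠ col (t + (b - 1)) := by
        intro x hx hxb
        have e : t + (b - 1) = N m := by omega
        refine ⟨?_, ?_⟩
        · rw [e, dN, dlt m _ (by omega)]
          exact ha _ (by omega)
        · rw [ht']
          exact hborn _ _ (by omega)
      rw [win_eq_iff]
      intro x y hx hy
      by_cases hxb : x = b - 1
      · by_cases hyb : y = b - 1
        · simp [hxb, hyb]
        · subst hxb
          exact iff_of_false (hne y hy hyb).1.symm (hne y hy hyb).2.symm
      · by_cases hyb : y = b - 1
        · subst hyb
          exact iff_of_false (hne x hx hxb).1 (hne x hx hxb).2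
        · rw [dlt m _ (by omega), dlt m _ (by omega)]
  refine not_wellQuasiOrderedLE_Av (fun m => seg (d m) 0 (N m + 1)) (fun m => ?_)
    fun m n hmn hle => ?_
  · have := haN m
    refine seg_mem_Av (by omega) fun t ht => ?_
    rw [seg, hwind m t ht, hwin]
    exact (w (i + t)).2
  · obtain ⟨s, hsn, hcol⟩ := exists_of_seg_le_seg hle
    simp only [zero_add] at hcol
    have hmn' := hN m n hmn
    have ham := haN m
    have e1 := (hcol a (N m) (by omega) (by omega)).1 (by rw [dN, dlt m _ (by omega)])
    -- If `N m` lands before `N n`, the class of its image has a point less than `b` earlier; pulled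
    -- back, that point would be in the class of `a` but after `a`. If it lands on `N n`, then `s >
    -- 0` and `s + a` has the colour of `a`.
    rcases Nat.lt_or_ge (s + N m) (N n) with h | h
    · rw [dlt n _ (by omega), dlt n _ h] at e1
      obtain ⟨z, hz1, hz2, hz3, hz4⟩ := hnear _ _ (by omega) e1
      have e2 := (hcol (z - s) (N m) (by omega) (by omega)).2
      rw [Nat.add_sub_cancel' (by omega), dN, dlt m _ (by omega), dlt n _ (by omega),
        dlt n _ h] at e2
      exact ha _ (by omega) (e2 hz4)
    · obtain e : s + N m = N n := by omega
      rw [e, dN, dlt n _ (by omega)] at e1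
      exact ha _ (by omega) e1

end FinEqRel

/-! ### Walks in digraphs without in-out cycles -/

open Relation

namespace Digraph

variable {V : Type*} {G : Digraph V}

theorem exists_isChain_of_reflTransGen {u v : V} (h : ReflTransGen G.Adj u v) :
    ∃ p : List V, p.IsChain G.Adj ∧ p.head? = some u ∧ p.getLast? = some v := by
  obtain ⟨p, hp, hv⟩ := List.exists_isChain_cons_of_relationReflTransGen h
  exact ⟨u :: p, hp, rfl, by rw [List.getLast?_eq_getLast_of_ne_nil (by simp), hv]⟩

/-- Two mutually reachable vertices lie on a common cycle. -/
theorem exists_isCycle_of_transGen {u v : V} (huv : TransGen G.Adj u v)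
    (hvu : TransGen G.Adj v u) : ∃ p, G.IsCycle p ∧ u ∈ p ∧ v ∈ p := by
  obtain ⟨p, hp, hpu, hpv⟩ := exists_isChain_of_reflTransGen huv.to_reflTransGen
  obtain ⟨x, hvx, hxu⟩ := TransGen.head'_iff.1 hvu
  obtain ⟨q, hq, hqx, hqu⟩ := exists_isChain_of_reflTransGen hxu
  have hpne : p ≠ [] := by rintro rfl; simp at hpu
  have hqne : q ≠ [] := by rintro rfl; simp at hqu
  refine ⟨p ++ q, ⟨?_, ?_, ?_⟩, ?_, ?_⟩
  · rw [List.isChain_append]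
    refine ⟨hp, hq, fun a ha b hb => ?_⟩
    rw [hpv, Option.mem_some_iff] at ha
    rw [hqx, Option.mem_some_iff] at hb
    rwa [← ha, ← hb]
  · have := List.length_pos_iff.2 hpne
    have := List.length_pos_iff.2 hqne
    rw [List.length_append]
    omega
  · rw [List.head?_append, List.getLast?_append, hpu, hqu]
    rfl
  · exact List.mem_append_left _ (List.mem_of_mem_head? hpu)
  · exact List.mem_append_left _ (List.mem_of_mem_getLast? hpv)

variable (G) in
/-- `v` lies on a cycle, and every vertex of its strong component has in-degree at most one. -/
def BackUnique (v : V) : Prop :=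
  TransGen G.Adj v v ∧ ∀ u, TransGen G.Adj u v → TransGen G.Adj v u →
    ∀ x y, G.Adj x u → G.Adj y u → x = y

variable (G) in
/-- `v` lies on a cycle, and every vertex of its strong component has out-degree at most one. -/
def FwdUnique (v : V) : Prop :=
  TransGen G.Adj v v ∧ ∀ u, TransGen G.Adj u v → TransGen G.Adj v u →
    ∀ x y, G.Adj u x → G.Adj u y → x = y

theorem BackUnique.eq {v x y : V} (h : G.BackUnique v) (hx : G.Adj x v) (hy : G.Adj y v) :
    x = y := h.2 v h.1 h.1 x y hx hy

theorem FwdUnique.eq {v x y : V} (h : G.FwdUnique v) (hx : G.Adj v x) (hy : G.Adj v y) :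
    x = y := h.2 v h.1 h.1 x y hx hy

/-- The only predecessor of `v` is the one on a cycle through `v`, so it stays in the strong
component. Hence the whole walk leading to `v` is forced. -/
theorem BackUnique.of_adj {u v : V} (h : G.BackUnique v) (huv : G.Adj u v) : G.BackUnique u := by
  obtain ⟨y, hvy, hyv⟩ := TransGen.tail'_iff.1 h.1
  obtain rfl := h.eq huv hyv
  exact ⟨TransGen.head' huv hvy, fun w hwu huw => h.2 w (hwu.tail huv) (TransGen.trans_right hvy huw)⟩

theorem FwdUnique.of_adj {u v : V} (h : G.FwdUnique u) (huv : G.Adj u v) : G.FwdUnique v := by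
  obtain ⟨y, huy, hyu⟩ := TransGen.head'_iff.1 h.1
  obtain rfl := h.eq huv huy
  exact ⟨TransGen.tail' hyu huv, fun w hwv hvw => h.2 w (hwv.trans_left hyu) (hvw.head huv)⟩

/-- A branching-in and a branching-out vertex of one strong component lie on a common closed walk,
which is an in-out cycle. -/
theorem backUnique_or_fwdUnique (h : ¬ ∃ p, G.IsInOutCycle p) {v : V}
    (hv : TransGen G.Adj v v) : G.BackUnique v ∨ G.FwdUnique v := by
  by_contra hcon
  simp only [BackUnique, FwdUnique, hv, true_and] at hcon
  push Not at hcon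
  obtain ⟨⟨u, huv, hvu, x, y, hx, hy, hxy⟩, w, hwv, hvw, x', y', hx', hy', hxy'⟩ := hcon
  obtain ⟨p, hp, hup, hwp⟩ := exists_isCycle_of_transGen (huv.trans hvw) (hwv.trans hvu)
  exact h ⟨p, hp, ⟨u, hup, two_le_inDeg_iff.2 ⟨x, y, hx, hy, hxy⟩⟩,
    w, hwp, two_le_outDeg_iff.2 ⟨x', y', hx', hy', hxy'⟩⟩

theorem transGen_of_lt {q : ℕ → V} {m i j : ℕ} (hq : ∀ t < m, G.Adj (q t) (q (t + 1)))
    (hij : i < j) (hj : j ≤ m) : TransGen G.Adj (q i) (q j) := by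
  induction j, hij using Nat.le_induction with
  | base => exact .single (hq i (by omega))
  | succ j hij ih => exact (ih (by omega)).tail (hq j (by omega))

/-- Without in-out cycles, a walk is, up to a part of bounded length, spent on cycles that it can
only have entered at its start and on cycles that it can never leave. -/
theorem exists_core [Finite V] (h : ¬ ∃ p, G.IsInOutCycle p) {q : ℕ → V} {m : ℕ}
    (hq : ∀ t < m, G.Adj (q t) (q (t + 1))) :
    ∃ a e, a ≤ e ∧ e ≤ m ∧ e ≤ a + Nat.card V + 1 ∧ (a = 0 ∨ G.BackUnique (q a)) ∧
      (e = m ∨ G.FwdUnique (q e)) := by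
  classical
  set a := Nat.findGreatest (fun t => G.BackUnique (q t)) m with ha
  have ha0 : a = 0 ∨ G.BackUnique (q a) := by
    by_cases h0 : a = 0
    · exact Or.inl h0
    · exact Or.inr (Nat.findGreatest_of_ne_zero ha.symm h0)
  have ham : a ≤ m := Nat.findGreatest_le m
  obtain ⟨e, hae, hem, he, hlt⟩ : ∃ e, a ≤ e ∧ e ≤ m ∧ (e = m ∨ G.FwdUnique (q e)) ∧
      ∀ t, a ≤ t → t < e → ¬ G.FwdUnique (q t) := by
    have hex : ∃ e, a ≤ e ∧ e ≤ m ∧ (e = m ∨ G.FwdUnique (q e)) := ⟨m, ham, le_rfl, .inl rfl⟩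
    obtain ⟨h1, h2, h3⟩ := Nat.find_spec hex
    refine ⟨Nat.find hex, h1, h2, h3, fun t hat ht hf => ?_⟩
    exact Nat.find_min hex ht ⟨hat, by omega, .inr hf⟩
  refine ⟨a, e, hae, hem, ?_, ha0, he⟩
  -- A vertex repeated strictly between `a` and `e` lies on a cycle, so it is `BackUnique`, against
  -- the maximality of `a`, or `FwdUnique`, against the minimality of `e`.
  have hinj : Function.Injective fun t : Fin (e - a - 1) => q (a + 1 + t) := by
    have key : ∀ s t : Fin (e - a - 1), s < t → q (a + 1 + s) ≠ q (a + 1 + t) := by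
      intro s t hst heq
      have hst' : (s : ℕ) < t := hst
      have hcyc := transGen_of_lt hq (show a + 1 + (s : ℕ) < a + 1 + t by omega) (by omega)
      rw [← heq] at hcyc
      rcases backUnique_or_fwdUnique h hcyc with h1 | h1
      · exact Nat.findGreatest_is_greatest (P := fun t => G.BackUnique (q t)) (n := m)
          (k := a + 1 + s) (by omega) (by omega) h1
      · exact hlt _ (by omega) (by omega) h1
    intro s t hst
    by_contra hne
    rcases lt_or_gt_of_ne hne with h1 | h1
    · exact key _ _ h1 hst
    · exact key _ _ h1 hst.symm
  have := Nat.card_le_card_of_injective _ hinj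
  rw [Nat.card_fin] at this
  omega

end Digraph

/-! ### Sufficiency: births and deaths of classes, forced extensions -/

namespace FinEqRel

instance finite_setoid (n : ℕ) : Finite (Setoid (Fin n)) :=
  Finite.of_injective (fun (r : Setoid (Fin n)) x y => r x y) fun r s h => by
    ext x y
    exact iff_of_eq (congrFun (congrFun h x) y)

instance finite_length_le (M : ℕ) : Finite {σ : FinEqRel // σ.length ≤ M} :=
  Finite.of_injective
    (fun σ => (⟨⟨σ.1.length, Nat.lt_succ_of_le σ.2⟩, σ.1.rel⟩ :
      Σ l : Fin (M + 1), Setoid (Fin l))) fun σ τ h => by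
    obtain ⟨⟨m, r⟩, hm⟩ := σ
    obtain ⟨⟨n, s⟩, hn⟩ := τ
    simp only [Sigma.mk.injEq, Fin.mk.injEq] at h
    obtain ⟨rfl, h⟩ := h
    simp only [heq_eq_eq] at h
    rw [Subtype.mk.injEq, h]

section Classes

variable {b : ℕ} {μ ν : Setoid (Fin b)}

/-- As the last point of `ν` starts no class, each class of `ν` has a representative in the overlap,
which injects the classes of `ν` into those of `μ`. A first point of `μ` that is alone is missed. -/
theorem card_quotient_le_and_lt (hμν : (overlapGraph b).Adj μ ν)
    (hν : ∃ x y : Fin b, (x : ℕ) < b - 1 ∧ (y : ℕ) = b - 1 ∧ ν x y) :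
    Nat.card (Quotient ν) ≤ Nat.card (Quotient μ) ∧
      ((∀ x y : Fin b, (x : ℕ) = 0 → 0 < (y : ℕ) → ¬ μ x y) →
        Nat.card (Quotient ν) < Nat.card (Quotient μ)) := by
  rw [overlapGraph_adj_iff] at hμν
  obtain ⟨hb, h⟩ := hμν
  have hrep : ∀ c : Quotient ν, ∃ x : Fin b, ∃ _ : (x : ℕ) + 1 < b, (⟦x⟧ : Quotient ν) = c := by
    intro c
    induction c using Quotient.inductionOn with
    | _ y =>
    by_cases hy : (y : ℕ) + 1 < b
    · exact ⟨y, hy, rfl⟩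
    · obtain ⟨x, y', hx, hy', hxy⟩ := hν
      obtain rfl : y = y' := Fin.ext (by omega)
      exact ⟨x, by omega, Quotient.sound hxy⟩
  choose f hf hfc using hrep
  let g : Quotient ν → Quotient μ := fun c => ⟦⟨f c + 1, hf c⟩⟧
  have hg : Function.Injective g := by
    intro c c' hcc
    rw [← hfc c, ← hfc c']
    exact Quotient.sound ((h _ _ (hf c) (hf c')).1 (Quotient.exact hcc))
  refine ⟨Nat.card_le_card_of_injective g hg, fun hμ => ?_⟩
  by_contra hcon
  obtain ⟨c, hc⟩ := (Function.Injective.bijective_of_nat_card_le hg (not_lt.1 hcon)).2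
    ⟦⟨0, by omega⟩⟧
  exact hμ ⟨0, by omega⟩ ⟨f c + 1, hf c⟩ rfl (by simp) (Quotient.exact hc.symm)

end Classes

variable {B : Finset FinEqRel}

theorem one_le_of_transGen {v w : FactorVertex B} (h : TransGen (factorGraph B).Adj v w) :
    1 ≤ maxLength B := by
  obtain ⟨x, hx, -⟩ := TransGen.head'_iff.1 h
  exact (overlapGraph_adj_iff.1 hx).1

theorem exists_rel_last_of_not_isSpecial {v : FactorVertex B} (hb : 1 ≤ maxLength B)
    (h : ¬ IsSpecial v) :
    ∃ x y : Fin (maxLength B), (x : ℕ) < maxLength B - 1 ∧ (y : ℕ) = maxLength B - 1 ∧ v.1 x y := by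
  by_contra hcon
  push Not at hcon
  refine h ⟨⟨maxLength B - 1, by omega⟩, fun i => Fin.le_def.2 (by
    change (i : ℕ) ≤ maxLength B - 1; omega), ?_⟩
  ext x
  constructor
  · intro hx
    by_contra hne
    exact hcon x _ (by
      have : (x : ℕ) ≠ maxLength B - 1 := fun e => hne (Fin.ext e)
      omega) rfl hx
  · rintro rfl
    exact v.1.refl' _

/-- If no special vertex lies on a cycle, then classes do not die along cycles either. -/
theorem exists_rel_first_of_transGen
    (hs : ∀ v : FactorVertex B, TransGen (factorGraph B).Adj v v → ¬ IsSpecial v)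
    {v : FactorVertex B} (hv : TransGen (factorGraph B).Adj v v) :
    ∃ x y : Fin (maxLength B), (x : ℕ) = 0 ∧ 0 < (y : ℕ) ∧ v.1 x y := by
  have hb := one_le_of_transGen hv
  by_contra hcon
  push Not at hcon
  obtain ⟨x, hvx, hxv⟩ := TransGen.head'_iff.1 hv
  -- No births on cycles: class counts cannot increase around the cycle, hence are constant, whereas
  -- a death at `v` would lower them strictly.
  have hle : ∀ w, ReflTransGen (factorGraph B).Adj w v → TransGen (factorGraph B).Adj v w →
      Nat.card (Quotient v.1) ≤ Nat.card (Quotient w.1) := by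
    intro w hw
    induction hw using ReflTransGen.head_induction_on with
    | refl => exact fun _ => le_rfl
    | head huw hwv ih =>
      intro hvu
      have hvw := hvu.tail huw
      exact (ih hvw).trans (card_quotient_le_and_lt huw (exists_rel_last_of_not_isSpecial hb
        (hs _ (TransGen.trans_right hwv hvw)))).1
  have h1 := hle x hxv (.single hvx)
  have h2 := (card_quotient_le_and_lt hvx (exists_rel_last_of_not_isSpecial hb
    (hs _ (TransGen.tail' hxv hvx)))).2 hcon
  omega

/-- Two colourings induce the same relation on the points `a, …, n - 1`. -/
def AgreeOn (c d : ℕ → ℕ) (a n : ℕ) : Prop :=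
  ∀ x y, a ≤ x → x < n → a ≤ y → y < n → (c x = c y ↔ d x = d y)

theorem AgreeOn.win_eq {c d : ℕ → ℕ} {a n b j : ℕ} (h : AgreeOn c d a n) (ha : a ≤ j)
    (hn : j + b ≤ n) : win b c j = win b d j :=
  win_eq_iff.2 fun x y hx hy => h _ _ (by omega) (by omega) (by omega) (by omega)

theorem AgreeOn.extend {c d : ℕ → ℕ} {a n k z : ℕ} (h : AgreeOn c d a n) (hz : a ≤ z)
    (hz' : z < n) (hc : c k = c z) (hd : d k = d z) {x y : ℕ} (hx : a ≤ x ∧ x < n ∨ x = k)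
    (hy : a ≤ y ∧ y < n ∨ y = k) : c x = c y ↔ d x = d y := by
  rcases hx with ⟨h1, h2⟩ | rfl <;> rcases hy with ⟨h3, h4⟩ | rfl
  · exact h _ _ h1 h2 h3 h4
  · rw [hc, hd]
    exact h _ _ h1 h2 hz hz'
  · rw [hc, hd]
    exact h _ _ hz hz' h3 h4
  · simp

/-- Uniqueness of predecessors makes the windows at the next point to the left equal. That point is
related to another one in its window, since no class dies on a cycle, and transitivity then fixes
its relation to all points, however distant. -/
theorem AgreeOn.extend_left
    (hs : ∀ v : FactorVertex B, TransGen (factorGraph B).Adj v v → ¬ IsSpecial v)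
    {c d : ℕ → ℕ} {a n : ℕ}
    (hc : ∀ i, i + maxLength B ≤ n → seg c i (maxLength B) ∈ Av B)
    (hd : ∀ i, i + maxLength B ≤ n → seg d i (maxLength B) ∈ Av B) (h : AgreeOn c d a n)
    (han : a + maxLength B ≤ n)
    (ha : ∃ hv, (factorGraph B).BackUnique ⟨win (maxLength B) c a, hv⟩) : AgreeOn c d 0 n := by
  induction a with
  | zero => exact h
  | succ a ih =>
    obtain ⟨hv, hu⟩ := ha
    have hb := one_le_of_transGen hu.1
    have hcv := hc a (by omega)
    have hdv := hd a (by omega)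
    have hca : (factorGraph B).Adj ⟨win (maxLength B) c a, hcv⟩ ⟨_, hv⟩ :=
      overlapGraph_adj_win hb c a
    have hda : (factorGraph B).Adj ⟨win (maxLength B) d a, hdv⟩ ⟨_, hv⟩ := by
      change (overlapGraph _).Adj (win (maxLength B) d a) (win (maxLength B) c (a + 1))
      rw [h.win_eq le_rfl han]
      exact overlapGraph_adj_win hb d a
    have heq : win (maxLength B) c a = win (maxLength B) d a :=
      congrArg Subtype.val (hu.eq hca hda)
    have hu' := hu.of_adj hca
    refine ih ?_ (by omega) ⟨hcv, hu'⟩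
    obtain ⟨x, y, hx, hy, hxy⟩ := exists_rel_first_of_transGen hs hu'.1
    have hxy' : win (maxLength B) d a x y := heq ▸ hxy
    have h1 : c a = c (a + y) := by simpa [hx] using win_apply x y |>.1 hxy
    have h2 : d a = d (a + y) := by simpa [hx] using win_apply x y |>.1 hxy'
    exact fun x' y' hx' hx'' hy' hy'' => h.extend (z := a + y) (by omega) (by omega) h1 h2
      (by omega) (by omega)

theorem AgreeOn.extend_right
    (hs : ∀ v : FactorVertex B, TransGen (factorGraph B).Adj v v → ¬ IsSpecial v)
    {c d : ℕ → ℕ} {a n : ℕ}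
    (hc : ∀ i, i + maxLength B ≤ n → seg c i (maxLength B) ∈ Av B)
    (hd : ∀ i, i + maxLength B ≤ n → seg d i (maxLength B) ∈ Av B) {t : ℕ} : ∀ {j : ℕ},
    AgreeOn c d a (j + maxLength B) → a ≤ j → j + maxLength B + t = n →
    (∃ hv, (factorGraph B).FwdUnique ⟨win (maxLength B) c j, hv⟩) → AgreeOn c d a n := by
  induction t with
  | zero =>
    rintro j h - rfl -
    exact h
  | succ t ih =>
    rintro j h haj hn ⟨hv, hu⟩
    have hb := one_le_of_transGen hu.1
    have hcv := hc (j + 1) (by omega)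
    have hdv := hd (j + 1) (by omega)
    have hca : (factorGraph B).Adj ⟨_, hv⟩ ⟨win (maxLength B) c (j + 1), hcv⟩ :=
      overlapGraph_adj_win hb c j
    have hda : (factorGraph B).Adj ⟨_, hv⟩ ⟨win (maxLength B) d (j + 1), hdv⟩ := by
      change (overlapGraph _).Adj (win (maxLength B) c j) (win (maxLength B) d (j + 1))
      rw [h.win_eq haj le_rfl]
      exact overlapGraph_adj_win hb d j
    have heq : win (maxLength B) c (j + 1) = win (maxLength B) d (j + 1) :=
      congrArg Subtype.val (hu.eq hca hda)
    have hu' := hu.of_adj hca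
    refine ih (j := j + 1) ?_ (by omega) (by omega) ⟨hcv, hu'⟩
    obtain ⟨x, y, hx, hy, hxy⟩ := exists_rel_last_of_not_isSpecial hb (hs _ hu'.1)
    have hxy' : win (maxLength B) d (j + 1) x y := heq ▸ hxy
    have e : j + 1 + (y : ℕ) = j + maxLength B := by omega
    have h1 : c (j + 1 + x) = c (j + 1 + y) := win_apply x y |>.1 hxy
    have h2 : d (j + 1 + x) = d (j + 1 + y) := win_apply x y |>.1 hxy'
    rw [e] at h1 h2
    exact fun x' y' hx' hx'' hy' hy'' => h.extend (z := j + 1 + x) (by omega) (by omega) h1.symm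
      h2.symm (by omega) (by omega)

/-- Every element of `Av B` is the extension of a core of bounded length, with unique extensions
to the left and to the right of the core. -/
theorem exists_core_decomposition (h : ¬ ∃ p, (factorGraph B).IsInOutCycle p)
    (hb : 1 ≤ maxLength B) {σ : FinEqRel} (hσ : σ ∈ Av B) :
    ∃ (c : ℕ → ℕ) (a m r : ℕ), σ = seg c 0 (a + m + r) ∧
      m ≤ Nat.card (FactorVertex B) + 1 + maxLength B ∧
      (a = 0 ∨ maxLength B ≤ m ∧
        ∃ hv, (factorGraph B).BackUnique ⟨win (maxLength B) c a, hv⟩) ∧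
      (r = 0 ∨ maxLength B ≤ m ∧
        ∃ hv, (factorGraph B).FwdUnique ⟨win (maxLength B) c (a + m - maxLength B), hv⟩) := by
  obtain ⟨c, hc⟩ := exists_eq_seg σ
  rcases Nat.lt_or_ge σ.length (maxLength B) with hlt | hge
  · exact ⟨c, 0, σ.length, 0, by simpa using hc, by omega, .inl rfl, .inl rfl⟩
  · obtain ⟨l, hl⟩ := Nat.exists_eq_add_of_le hge
    have hmem : ∀ i, i ≤ l → seg c i (maxLength B) ∈ Av B := fun i hi => by
      rw [hc] at hσ
      exact seg_mem_Av_of_seg_mem_Av hσ (by omega)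
    -- Past the last window the walk is frozen, only to make `q` total.
    let q : ℕ → FactorVertex B := fun i =>
      ⟨win (maxLength B) c (min i l), hmem _ (min_le_right _ _)⟩
    have hq : ∀ t < l, (factorGraph B).Adj (q t) (q (t + 1)) := by
      intro t ht
      change (overlapGraph _).Adj (win _ c (min t l)) (win _ c (min (t + 1) l))
      rw [min_eq_left ht.le, min_eq_left ht]
      exact overlapGraph_adj_win hb c t
    have hval : ∀ i ≤ l, ∀ P : FactorVertex B → Prop, P (q i) →
        ∃ hv, P ⟨win (maxLength B) c i, hv⟩ := by
      intro i hi P hP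
      refine ⟨hmem i hi, ?_⟩
      have : q i = ⟨win (maxLength B) c i, hmem i hi⟩ :=
        Subtype.ext (by simp only [q, min_eq_left hi])
      rwa [← this]
    obtain ⟨a, e, hae, hel, hea, ha, he⟩ := Digraph.exists_core h hq
    refine ⟨c, a, e - a + maxLength B, l - e, ?_, by omega,
      ha.imp_right fun ha => ⟨by omega, hval a (by omega) _ ha⟩, ?_⟩
    · have : a + (e - a + maxLength B) + (l - e) = σ.length := by omega
      rw [this]
      exact hc
    · rcases he with he | he
      · exact .inl (by omega)
      · refine .inr ⟨by omega, ?_⟩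
        have : a + (e - a + maxLength B) - maxLength B = e := by omega
        rw [this]
        exact hval e hel _ he

theorem wellQuasiOrderedLE_Av (h : ¬ ∃ p, (factorGraph B).IsInOutCycle p)
    (hs : ∀ v : FactorVertex B, TransGen (factorGraph B).Adj v v → ¬ IsSpecial v)
    (hb : 1 ≤ maxLength B) : WellQuasiOrderedLE ↥(Av B) := by
  refine ⟨fun f => ?_⟩
  choose c a m r hf hm hl hr using fun k => exists_core_decomposition h hb (f k).2
  have hwqo := (Finite.wellQuasiOrdered
      ((· = ·) : {σ : FinEqRel // σ.length ≤ Nat.card (FactorVertex B) + 1 + maxLength B} →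
        _ → Prop)).prod ((wellQuasiOrdered_le (α := ℕ)).prod (wellQuasiOrdered_le (α := ℕ)))
  obtain ⟨i, j, hij, hcore, ha, hr'⟩ :=
    hwqo fun k => (⟨seg (c k) (a k) (m k), hm k⟩, a k, r k)
  refine ⟨i, j, hij, ?_⟩
  replace hcore : seg (c i) (a i) (m i) = seg (c j) (a j) (m j) := congrArg Subtype.val hcore
  simp only at ha hr'
  have hmm : m i = m j := congrArg FinEqRel.length hcore
  obtain ⟨s, hsa⟩ := Nat.exists_eq_add_of_le ha
  have hci := hf i ▸ (f i).2
  have hcj := hf j ▸ (f j).2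
  let d : ℕ → ℕ := fun x => c j (s + x)
  have hd : ∀ t, t + maxLength B ≤ a i + m i + r i → seg d t (maxLength B) ∈ Av B := by
    intro t ht
    refine mem_Av_of_le (seg_le_seg (j := s + t) (d := c j) (s := 0) (by omega) ?_)
      (seg_mem_Av_of_seg_mem_Av hcj (i := s + t) (m := maxLength B) (by omega))
    intro x y _ _
    simp only [d, zero_add, add_assoc]
  have hc : ∀ t, t + maxLength B ≤ a i + m i + r i → seg (c i) t (maxLength B) ∈ Av B :=
    fun t ht => seg_mem_Av_of_seg_mem_Av hci ht
  have h0 : AgreeOn (c i) d (a i) (a i + m i) := by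
    rw [seg, seg, ← hmm] at hcore
    have := eq_of_heq (FinEqRel.mk.inj hcore).2
    intro x y hx hx' hy hy'
    have h1 := win_eq_iff.1 this (x - a i) (y - a i) (by omega) (by omega)
    have e1 : ∀ x, a i ≤ x → a i + (x - a i) = x := fun x hx => by omega
    have e2 : ∀ x, a i ≤ x → a j + (x - a i) = s + x := fun x hx => by omega
    rwa [e1 x hx, e1 y hy, e2 x hx, e2 y hy] at h1
  have h1 : AgreeOn (c i) d (a i) (a i + m i + r i) := by
    rcases hr i with h2 | ⟨h2, h3⟩
    · rw [h2]
      exact h0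
    · refine AgreeOn.extend_right hs hc hd (t := r i) ?_ ?_ ?_ h3
      · rwa [Nat.sub_add_cancel (by omega)]
      · omega
      · omega
  have h2 : AgreeOn (c i) d 0 (a i + m i + r i) := by
    rcases hl i with h2 | ⟨h2, h3⟩
    · rwa [h2] at h1 ⊢
    · exact h1.extend_left hs hc hd (by omega) h3
  change (f i : FinEqRel) ≤ f j
  rw [hf i, hf j]
  refine seg_le_seg (s := s) (by omega) fun x y hx hy => ?_
  simpa [d] using h2 x y (by omega) hx (by omega) hy

theorem Av_eq_empty_of_maxLength_eq_zero (hB : B.Nonempty) (h : maxLength B = 0) :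
    Av B = ∅ := by
  obtain ⟨β, hβ⟩ := hB
  have hlen : β.length = 0 := Nat.le_zero.1 (h ▸ Finset.le_sup (f := FinEqRel.length) hβ)
  refine Set.eq_empty_of_forall_notMem fun σ hσ => hσ β hβ ?_
  have : IsEmpty (Fin β.length) := by rw [hlen]; infer_instance
  exact ⟨isEmptyElim, ⟨0, isEmptyElim⟩, isEmptyElim⟩

end FinEqRel

theorem theorem8p3 (B : Finset FinEqRel) (hB : B.Nonempty) :
    WellQuasiOrderedLE ↥(FinEqRel.Av B) ↔
      (¬ ∃ c : List (FinEqRel.FactorVertex B), (FinEqRel.factorGraph B).IsInOutCycle c) ∧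
      (¬ ∃ c : List (FinEqRel.FactorVertex B), (FinEqRel.factorGraph B).IsCycle c ∧
        ∃ ν ∈ c, FinEqRel.IsSpecial ν) := by
  constructor
  · intro hw
    exact ⟨fun ⟨c, hc⟩ => FinEqRel.not_wellQuasiOrderedLE_of_isInOutCycle hc hw,
      fun ⟨c, hc, ν, hν, hs⟩ =>
        FinEqRel.not_wellQuasiOrderedLE_of_isSpecial_mem_isCycle hc hν hs hw⟩
  · rintro ⟨h1, h2⟩
    -- For `b = 0` the graph has no edges and says nothing, but `B` contains the empty relation,
    -- which embeds in everything.
    rcases Nat.eq_zero_or_pos (FinEqRel.maxLength B) with h0 | hb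
    · rw [FinEqRel.Av_eq_empty_of_maxLength_eq_zero hB h0]
      exact ⟨fun f => (f 0).2.elim⟩
    · refine FinEqRel.wellQuasiOrderedLE_Av h1 (fun v hv hs => ?_) hb
      obtain ⟨p, hp, hvp, -⟩ := Digraph.exists_isCycle_of_transGen hv hv
      exact h2 ⟨p, hp, v, hvp, hs⟩
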